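/- Let $\lambda>0$ and let $n\ge 1$ be an integer. Consider the magnetic Ginzburg--Landau equations on $\mathbb{R}^2$ $$-\Delta_A\psi+\tfrac{\lambda}{2}(|\psi|^2-1)\psi=0,\qquad \nabla\times\nabla\times A-\operatorname{Im}(\bar\psi\,\nabla_A\psi)=0,$$ for $\psi:\mathbb{R}^2\to\mathbb{C}$ and $A:\mathbb{R}^2\to\mathbb{R}^2$, where $\nabla_A=\nabla-iA$, $\Delta_A=\nabla_A\cdot\nabla_A$, $\nabla\times A=\partial_1A_2-\partial_2A_1$ for a vector field $A$, and $\nabla\times\xi=(\partial_2\xi,-\partial_1\xi)$ for a scalar $\xi$. Let $f,a$ be the profiles of an $n$-vortex, i.e. real functions of $r$ such that for some $C^2$ solution $(\psi,A)$ of these equations on $\mathbb{R}^2$, in polar coordinates $(r,\theta)$ with $r>0$, $$\psi=f(r)e^{in\theta},\qquad A=n\,\frac{a(r)}{r}\,(-\sin\theta,\cos\theta),$$ and such that $1-f\in H^1(r\,dr)$, $a/r\in L^2_{\mathrm{loc}}(r\,dr)$ and $a'/r\in L^2(r\,dr)$ on $[0,\infty)$. Then $f$ is differentiable on $(0,\infty)$,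 and for every $r>0$: $$f'(r)>\frac{n(1-a(r))}{r}f(r)\ \text{ if }\lambda<1,\qquad f'(r)<\frac{n(1-a(r))}{r}f(r)\ \text{ if }\lambda>1.$$ -/

import Mathlib

open MeasureTheory Set

noncomputable section

namespace MagneticGL

/-- Partial derivative in the first variable of a function on the plane. -/
def pd1 {E : Type*} [NormedAddCommGroup E] [NormedSpace ℝ E] (u : ℝ × ℝ → E) (x : ℝ × ℝ) : E :=
  fderiv ℝ u x (1, 0)

/-- Partial derivative in the second variable of a function on the plane. -/
def pd2 {E : Type*} [NormedAddCommGroup E] [NormedSpace ℝ E] (u : ℝ × ℝ → E) (x : ℝ × ℝ) : E :=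
  fderiv ℝ u x (0, 1)

/-- First component of the covariant gradient `∇_A ψ = ∇ψ - i A ψ`. -/
def cov1 (A : ℝ × ℝ → ℝ × ℝ) (ψ : ℝ × ℝ → ℂ) (x : ℝ × ℝ) : ℂ :=
  pd1 ψ x - Complex.I * ((A x).1 : ℂ) * ψ x

/-- Second component of the covariant gradient `∇_A ψ = ∇ψ - i A ψ`. -/
def cov2 (A : ℝ × ℝ → ℝ × ℝ) (ψ : ℝ × ℝ → ℂ) (x : ℝ × ℝ) : ℂ :=
  pd2 ψ x - Complex.I * ((A x).2 : ℂ) * ψ x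

/-- The covariant Laplacian `Δ_A = ∇_A · ∇_A`. -/
def covLaplacian (A : ℝ × ℝ → ℝ × ℝ) (ψ : ℝ × ℝ → ℂ) (x : ℝ × ℝ) : ℂ :=
  cov1 A (cov1 A ψ) x + cov2 A (cov2 A ψ) x

/-- The scalar curl `∇ × A = ∂₁A₂ - ∂₂A₁` of a planar vector field (the magnetic field). -/
def curl (A : ℝ × ℝ → ℝ × ℝ) (x : ℝ × ℝ) : ℝ :=
  pd1 (fun y => (A y).2) x - pd2 (fun y => (A y).1) x

/-- The vector curl of a scalar, `∇ × ξ = (∂₂ξ, -∂₁ξ)`. It is the formal adjoint of `curl`, so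
that `curlScalar (curl A)` is the `A`-gradient of `½ ∫ (curl A)²`. -/
def curlScalar (ξ : ℝ × ℝ → ℝ) (x : ℝ × ℝ) : ℝ × ℝ :=
  (pd2 ξ x, -pd1 ξ x)

/-- The current `Im (ψ̄ ∇_A ψ)`. -/
def current (A : ℝ × ℝ → ℝ × ℝ) (ψ : ℝ × ℝ → ℂ) (x : ℝ × ℝ) : ℝ × ℝ :=
  ((starRingEnd ℂ (ψ x) * cov1 A ψ x).im, (starRingEnd ℂ (ψ x) * cov2 A ψ x).im)

/-- Classical (`C²`) solutions on the whole plane of the magnetic Ginzburg-Landau equations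
with coupling constant `lam`. -/
structure IsGLSolution (lam : ℝ) (ψ : ℝ × ℝ → ℂ) (A : ℝ × ℝ → ℝ × ℝ) : Prop where
  contDiff_psi : ContDiff ℝ 2 ψ
  contDiff_A : ContDiff ℝ 2 A
  eq_psi : ∀ x, -covLaplacian A ψ x + ((lam / 2 * (‖ψ x‖ ^ 2 - 1) : ℝ) : ℂ) * ψ x = 0
  eq_A : ∀ x, curlScalar (curl A) x - current A ψ x = 0

/-- The fields `(ψ, A)` are equivariant of degree `n` with profiles `f, a`:
`ψ = f(r) e^{inθ}` and `A = n (a(r) / r) x̂^⊥`, with `x̂^⊥ = (-sin θ, cos θ)`.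
Only the values of `f` and `a` on `(0, ∞)` are involved. -/
def HasProfiles (n : ℤ) (f a : ℝ → ℝ) (ψ : ℝ × ℝ → ℂ) (A : ℝ × ℝ → ℝ × ℝ) : Prop :=
  ∀ r θ : ℝ, 0 < r →
    ψ (r * Real.cos θ, r * Real.sin θ) = (f r : ℂ) * Complex.exp (Complex.I * (n : ℂ) * (θ : ℂ)) ∧
    A (r * Real.cos θ, r * Real.sin θ) =
      (n * (a r / r) * (-Real.sin θ), n * (a r / r) * Real.cos θ)

/-- The class `1 - f ∈ H¹(r dr)`, `a / r ∈ L²_loc(r dr)`, `a' / r ∈ L²(r dr)` on `[0, ∞)`,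
for profiles that are differentiable on `(0, ∞)`. -/
structure InProfileClass (f a : ℝ → ℝ) : Prop where
  one_sub_f : IntegrableOn (fun r => (1 - f r) ^ 2 * r) (Ioi 0)
  deriv_f : IntegrableOn (fun r => (deriv f r) ^ 2 * r) (Ioi 0)
  a_div : ∀ R : ℝ, 0 < R → IntegrableOn (fun r => (a r / r) ^ 2 * r) (Ioc 0 R)
  deriv_a_div : IntegrableOn (fun r => (deriv a r / r) ^ 2 * r) (Ioi 0)

/-- `f, a` are the profiles of an `n`-vortex (centred at the origin) for the coupling constant
`lam`: the corresponding equivariant fields solve the Ginzburg-Landau equations in the plane,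
and `(f, a)` lies in the class in which the radial energy is considered. The functions `f, a`
are automatically `C²` on `(0, ∞)`. -/
def IsVortexProfile (lam : ℝ) (n : ℤ) (f a : ℝ → ℝ) : Prop :=
  (∃ (ψ : ℝ × ℝ → ℂ) (A : ℝ × ℝ → ℝ × ℝ), IsGLSolution lam ψ A ∧ HasProfiles n f a ψ A) ∧
    InProfileClass f a

end MagneticGL

end

/-! Put b = 1 - a, N = n and B = a'/r. The defect w = f' - N b f/r and the quantity η = N B -
(λ/2)(1 - f²) vanish for solutions of the Bogomolny equations at λ = 1. In general they satisfy w' =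
-(1 + N b)/r · w + f η and η' = f w - (1 - λ) f f'. With f > 0 this system is cooperative. Once f' ≥
0 is known, its forcing has the sign of λ - 1.

Let λ < 1, and suppose w < 0 at some radius. If η ≤ 0 there, then both stay nonpositive to the right
and η decreases strictly away from 0, against η → 0 at infinity. If η > 0 there, then going left η
stays positive and r w stays below a negative constant, against r w → 0 at the origin. So w ≥ 0, and
a zero of w would force w to become negative just after it. For λ > 1 the same argument applies to
(-w, -η). This is `pos_of_cooperative_system`.

The signs it needs come from the radial equations. Square integrability of B gives b B ≥ 0
(`b_mul_B_nonneg`), hence 0 < b ≤ 1, B ≥ 0 and B → 0. A Lyapunov function excludes interior maxima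
of f² (`no_interior_max`), hence f > 0 and f' ≥ 0. The radial equations themselves are the planar
ones restricted to the positive x-axis (`isRadialVortex_of_isVortexProfile`). -/

open Filter Topology

namespace MagneticGL

/-! ### One-variable calculus: monotonicity, first exits, unique continuation, decay. -/

section Calculus

variable {g g' : ℝ → ℝ} {l u : ℝ}

theorem le_of_hasDerivAt_nonneg (hlu : l ≤ u) (h : ∀ x ∈ Icc l u, HasDerivAt g (g' x) x)
    (h0 : ∀ x ∈ Icc l u, 0 ≤ g' x) : g l ≤ g u := by
  refine monotoneOn_of_deriv_nonneg (convex_Icc l u)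
    (fun x hx => (h x hx).continuousAt.continuousWithinAt)
    (fun x hx => (h x (interior_subset hx)).differentiableAt.differentiableWithinAt)
    (fun x hx => ?_) (left_mem_Icc.2 hlu) (right_mem_Icc.2 hlu) hlu
  rw [(h x (interior_subset hx)).deriv]
  exact h0 x (interior_subset hx)

theorem lt_of_hasDerivAt_pos (hlu : l < u) (h : ∀ x ∈ Icc l u, HasDerivAt g (g' x) x)
    (h0 : ∀ x ∈ Ioo l u, 0 < g' x) : g l < g u := by
  refine strictMonoOn_of_deriv_pos (convex_Icc l u)
    (fun x hx => (h x hx).continuousAt.continuousWithinAt)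
    (fun x hx => ?_) (left_mem_Icc.2 hlu.le) (right_mem_Icc.2 hlu.le) hlu
  rw [(h x (interior_subset hx)).deriv]
  exact h0 x (by simpa using hx)

theorem le_of_hasDerivAt_nonpos (hlu : l ≤ u) (h : ∀ x ∈ Icc l u, HasDerivAt g (g' x) x)
    (h0 : ∀ x ∈ Icc l u, g' x ≤ 0) : g u ≤ g l :=
  neg_le_neg_iff.1 <| le_of_hasDerivAt_nonneg (g := fun x => -g x) (g' := fun x => -g' x) hlu
    (fun x hx => (h x hx).neg) (fun x hx => neg_nonneg.2 (h0 x hx))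

/-- A monotone function with equal endpoint values has vanishing derivative. -/
theorem hasDerivAt_eq_zero_of_nonpos_of_eq (h : ∀ x ∈ Icc l u, HasDerivAt g (g' x) x)
    (h0 : ∀ x ∈ Icc l u, g' x ≤ 0) (heq : g l ≤ g u) : ∀ x ∈ Ioo l u, g' x = 0 := by
  intro x hx
  have hc : g =ᶠ[𝓝 x] fun _ => g l := by
    filter_upwards [Ioo_mem_nhds hx.1 hx.2] with y hy
    have h1 : g y ≤ g l := le_of_hasDerivAt_nonpos hy.1.le
      (fun z hz => h z ⟨hz.1, hz.2.trans hy.2.le⟩) (fun z hz => h0 z ⟨hz.1, hz.2.trans hy.2.le⟩)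
    have h2 : g u ≤ g y := le_of_hasDerivAt_nonpos hy.2.le
      (fun z hz => h z ⟨hy.1.le.trans hz.1, hz.2⟩) (fun z hz => h0 z ⟨hy.1.le.trans hz.1, hz.2⟩)
    linarith
  exact (h x ⟨hx.1.le, hx.2.le⟩).unique ((hasDerivAt_const x (g l)).congr_of_eventuallyEq hc)

/-- Continuous induction to the right: a strict sign cannot be lost at a first zero. -/
theorem neg_of_first_exit {w : ℝ → ℝ} (hw : ContinuousOn w (Icc l u)) (hl : w l < 0)
    (hstep : ∀ s ∈ Icc l u, (∀ t ∈ Icc l s, w t ≤ 0) → w s < 0) : ∀ t ∈ Icc l u, w t < 0 := by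
  intro t ht
  by_contra! hwt
  have hcomp : IsCompact (Icc l u ∩ w ⁻¹' Ici 0) :=
    isCompact_Icc.of_isClosed_subset (hw.preimage_isClosed_of_isClosed isClosed_Icc isClosed_Ici)
      inter_subset_left
  obtain ⟨s, ⟨hs, hws⟩, hmin⟩ := hcomp.exists_isLeast ⟨t, ht, hwt⟩
  simp only [mem_preimage, mem_Ici] at hws
  have hs0 : w s ≤ 0 := by
    have hsub : Icc l s ⊆ Icc l u := Icc_subset_Icc_right hs.2
    obtain ⟨x, hx, hx0⟩ := intermediate_value_Icc hs.1 (hw.mono hsub)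
      (show (0 : ℝ) ∈ Icc (w l) (w s) from ⟨hl.le, hws⟩)
    have hsx : s ≤ x := hmin ⟨hsub hx, hx0.ge⟩
    rw [le_antisymm hsx hx.2, hx0]
  refine absurd (hstep s hs fun y hy => ?_) (not_lt.2 hws)
  rcases hy.2.eq_or_lt with rfl | hlt
  · exact hs0
  · by_contra! hy0
    exact absurd (hmin ⟨⟨hy.1, hy.2.trans hs.2⟩, hy0.le⟩) (not_le.2 hlt)

/-- Continuous induction to the left. -/
theorem neg_of_last_exit {w : ℝ → ℝ} (hw : ContinuousOn w (Icc l u)) (hu : w u < 0)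
    (hstep : ∀ s ∈ Icc l u, (∀ t ∈ Icc s u, w t ≤ 0) → w s < 0) : ∀ t ∈ Icc l u, w t < 0 := by
  intro t ht
  have key := neg_of_first_exit (w := fun x => w (-x)) (l := -u) (u := -l)
    (hw.comp continuous_neg.continuousOn fun x hx => ⟨by linarith [hx.2], by linarith [hx.1]⟩)
    (by simpa using hu)
    (fun s hs h => hstep (-s) ⟨by linarith [hs.2], by linarith [hs.1]⟩ fun y hy => by
      simpa using h (-y) ⟨by linarith [hy.2], by linarith [hy.1]⟩)
    (-t) ⟨by linarith [ht.2], by linarith [ht.1]⟩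
  simpa using key

/-- Unique continuation for a second order linear equation on the half-line. -/
theorem eq_zero_of_linear_ode {y y' p q : ℝ → ℝ} (hy : ∀ r, 0 < r → HasDerivAt y (y' r) r)
    (hy' : ∀ r, 0 < r → HasDerivAt y' (p r * y' r + q r * y r) r)
    (hp : ContinuousOn p (Ioi 0)) (hq : ContinuousOn q (Ioi 0)) {r₀ : ℝ} (hr₀ : 0 < r₀)
    (h0 : y r₀ = 0) (h0' : y' r₀ = 0) : ∀ r, 0 < r → y r = 0 := by
  intro r hr
  have hsub : uIcc r₀ r ⊆ Ioi 0 := fun x hx => lt_of_lt_of_le (lt_min hr₀ hr) hx.1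
  obtain ⟨C, hC⟩ := isCompact_uIcc.exists_bound_of_continuousOn (hp.mono hsub)
  obtain ⟨D, hD⟩ := isCompact_uIcc.exists_bound_of_continuousOn (hq.mono hsub)
  -- Gronwall for y² + y'²: the terms 2yy', 2py'² and 2qyy' of its derivative contribute 1, 2C and
  -- D.
  set K := 1 + 2 * C + D with hK
  have hE : ∀ x, 0 < x → HasDerivAt (fun s => y s ^ 2 + y' s ^ 2)
      (2 * y x * y' x + 2 * y' x * (p x * y' x + q x * y x)) x := fun x hx => by
    refine (((hy x hx).pow 2).add ((hy' x hx).pow 2)).congr_deriv ?_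
    push_cast; ring
  have hbound : ∀ x ∈ uIcc r₀ r, |2 * y x * y' x + 2 * y' x * (p x * y' x + q x * y x)| ≤
      K * (y x ^ 2 + y' x ^ 2) := fun x hx => by
    have h1 := abs_le.1 (hC x hx)
    have h2 := abs_le.1 (hD x hx)
    have h3 : |2 * y x * y' x| ≤ y x ^ 2 + y' x ^ 2 := abs_le.2
      ⟨by nlinarith [sq_nonneg (y x + y' x)], by nlinarith [sq_nonneg (y x - y' x)]⟩
    have h4 : |2 * y' x * (p x * y' x)| ≤ 2 * C * (y x ^ 2 + y' x ^ 2) := abs_le.2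
      ⟨by nlinarith [sq_nonneg (y x), sq_nonneg (y' x)],
        by nlinarith [sq_nonneg (y x), sq_nonneg (y' x)]⟩
    have h5 : |2 * y' x * (q x * y x)| ≤ D * (y x ^ 2 + y' x ^ 2) := by
      have : 2 * y' x * (q x * y x) = q x * (2 * y x * y' x) := by ring
      rw [this, abs_mul]
      exact mul_le_mul (hD x hx) h3 (abs_nonneg _) ((norm_nonneg _).trans (hD x hx))
    calc _ = |2 * y x * y' x + 2 * y' x * (p x * y' x) + 2 * y' x * (q x * y x)| := by
          congr 1; ring
      _ ≤ _ := (abs_add_three _ _ _).trans (by rw [hK]; linarith)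
  have hexp : ∀ c x : ℝ, HasDerivAt (fun s => Real.exp (c * s)) (Real.exp (c * x) * c) x :=
    fun c x => by simpa using ((hasDerivAt_id x).const_mul c).exp
  have hfin : y r ^ 2 + y' r ^ 2 ≤ 0 := by
    rcases le_total r₀ r with hle | hle
    · have := le_of_hasDerivAt_nonpos hle
        (fun x hx => (hE x (hr₀.trans_le hx.1)).mul (hexp (-K) x)) (fun x hx => by
          have := (abs_le.1 (hbound x (by rwa [uIcc_of_le hle]))).2
          nlinarith [Real.exp_pos (-K * x)])
      simp only [h0, h0', Pi.mul_apply] at this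
      nlinarith [Real.exp_pos (-K * r)]
    · have := le_of_hasDerivAt_nonneg hle
        (fun x hx => (hE x (hr.trans_le hx.1)).mul (hexp K x)) (fun x hx => by
          have := (abs_le.1 (hbound x (by rwa [uIcc_of_ge hle]))).1
          nlinarith [Real.exp_pos (K * x)])
      simp only [h0, h0', Pi.mul_apply] at this
      nlinarith [Real.exp_pos (K * r)]
  nlinarith [sq_nonneg (y r), sq_nonneg (y' r)]

/-- A function in `L²(r dr)` is small at arbitrarily large radii. -/
theorem exists_sq_lt_of_integrableOn {g : ℝ → ℝ}
    (hg : IntegrableOn (fun r => g r ^ 2 * r) (Ioi 0)) {κ : ℝ} (hκ : 0 < κ) (R : ℝ) :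
    ∃ r, R < r ∧ g r ^ 2 < κ := by
  by_contra! h
  -- Beyond radius 1 the weight r is at least 1 and can be dropped.
  set S := max R 1
  have hint : IntegrableOn (fun _ : ℝ => κ) (Ioi S) := by
    refine Integrable.mono' (hg.mono_set (Ioi_subset_Ioi (zero_le_one.trans (le_max_right R 1))))
      aestronglyMeasurable_const ?_
    filter_upwards [ae_restrict_mem measurableSet_Ioi] with x hx
    have h1 : 1 ≤ x := (le_max_right R 1).trans (mem_Ioi.1 hx).le
    have h2 := h x ((le_max_left R 1).trans_lt hx)
    rw [Real.norm_of_nonneg hκ.le]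
    nlinarith
  rw [integrableOn_const_iff] at hint
  simp [hκ.ne'] at hint

/-- A function in `H¹(r dr)` tends to zero at infinity. -/
theorem tendsto_zero_of_integrableOn {g g' : ℝ → ℝ} (h : ∀ r, 0 < r → HasDerivAt g (g' r) r)
    (hc : ContinuousOn g' (Ioi 0))
    (hg : IntegrableOn (fun r => g r ^ 2 * r) (Ioi 0))
    (hg' : IntegrableOn (fun r => g' r ^ 2 * r) (Ioi 0)) : Tendsto g atTop (𝓝 0) := by
  have hsub : Ioi (1 : ℝ) ⊆ Ioi 0 := Ioi_subset_Ioi zero_le_one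
  have hcg : ContinuousOn g (Ioi 1) :=
    fun x hx => (h x (hsub hx)).continuousAt.continuousWithinAt
  have hsq := tendsto_zero_of_hasDerivAt_of_integrableOn_Ioi (a := 1) (f := fun r => g r ^ 2)
    (f' := fun r => 2 * g r * g' r)
    (fun x hx => ((h x (hsub hx)).pow 2).congr_deriv (by simp)) ?_ ?_
  · have := hsq.sqrt
    simp only [Real.sqrt_sq_eq_abs, Real.sqrt_zero] at this
    exact tendsto_zero_iff_abs_tendsto_zero _ |>.2 this
  · refine Integrable.mono' ((hg.mono_set hsub).add (hg'.mono_set hsub))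
      (((continuousOn_const.mul hcg).mul (hc.mono hsub)).aestronglyMeasurable measurableSet_Ioi) ?_
    filter_upwards [ae_restrict_mem measurableSet_Ioi] with x hx
    have hx : 1 < x := hx
    have h3 : |2 * g x * g' x| ≤ g x ^ 2 + g' x ^ 2 := abs_le.2
      ⟨by nlinarith [sq_nonneg (g x + g' x)], by nlinarith [sq_nonneg (g x - g' x)]⟩
    rw [Real.norm_eq_abs, Pi.add_apply]
    nlinarith [sq_nonneg (g x), sq_nonneg (g' x)]
  · refine Integrable.mono' (hg.mono_set hsub)
      ((hcg.pow 2).aestronglyMeasurable measurableSet_Ioi) ?_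
    filter_upwards [ae_restrict_mem measurableSet_Ioi] with x hx
    have hx : 1 < x := hx
    rw [Real.norm_of_nonneg (sq_nonneg _)]
    nlinarith [sq_nonneg (g x)]

end Calculus

/-- The radial Ginzburg-Landau system for the profile `f`, its derivative `f'`, the function
`b = 1 - a` and the rescaled magnetic field `B = a' / r`, with the boundary behaviour of a
vortex. -/
structure IsRadialVortex (lam N : ℝ) (f f' b B : ℝ → ℝ) : Prop where
  lam_pos : 0 < lam
  N_pos : 0 < N
  hasDerivAt_f : ∀ r, 0 < r → HasDerivAt f (f' r) r
  hasDerivAt_f' : ∀ r, 0 < r → HasDerivAt f'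
    (-(f' r / r) + N ^ 2 * b r ^ 2 / r ^ 2 * f r + lam / 2 * (f r ^ 2 - 1) * f r) r
  hasDerivAt_b : ∀ r, 0 < r → HasDerivAt b (-(r * B r)) r
  hasDerivAt_B : ∀ r, 0 < r → HasDerivAt B (-(b r * f r ^ 2 / r)) r
  f_zero : Tendsto f (𝓝[>] 0) (𝓝 0)
  b_zero : Tendsto b (𝓝[>] 0) (𝓝 1)
  f'_zero : Tendsto (fun r => r * f' r) (𝓝[>] 0) (𝓝 0)
  f_infty : Tendsto f atTop (𝓝 1)
  B_int : IntegrableOn (fun r => B r ^ 2 * r) (Ioi 0)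

/-! ### Signs of b and B; absence of interior maxima of f². -/

namespace IsRadialVortex

variable {lam N : ℝ} {f f' b B : ℝ → ℝ}

theorem continuousOn_f (h : IsRadialVortex lam N f f' b B) : ContinuousOn f (Ioi 0) :=
  fun r hr => (h.hasDerivAt_f r hr).continuousAt.continuousWithinAt

theorem continuousOn_b (h : IsRadialVortex lam N f f' b B) : ContinuousOn b (Ioi 0) :=
  fun r hr => (h.hasDerivAt_b r hr).continuousAt.continuousWithinAt

/-- Since (bB)' = -rB² - b²f²/r ≤ 0, a negative value of bB persists to the right. There (B²)' =
-2bBf²/r ≥ 0, so B² stays bounded away from 0, against B ∈ L²(r dr). -/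
theorem b_mul_B_nonneg (h : IsRadialVortex lam N f f' b B) {r : ℝ} (hr : 0 < r) :
    0 ≤ b r * B r := by
  by_contra! hneg
  have hanti : ∀ s, r ≤ s → b s * B s < 0 := fun s hs => by
    refine (le_of_hasDerivAt_nonpos hs (fun x hx =>
      (h.hasDerivAt_b x (hr.trans_le hx.1)).mul (h.hasDerivAt_B x (hr.trans_le hx.1)))
      (fun x hx => ?_)).trans_lt hneg
    have hx0 : 0 < x := hr.trans_le hx.1
    have h1 : 0 ≤ b x ^ 2 * f x ^ 2 / x := by positivity
    have h2 : 0 ≤ x * B x ^ 2 := by positivity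
    calc _ = -(x * B x ^ 2) - b x ^ 2 * f x ^ 2 / x := by ring
      _ ≤ 0 := by linarith
  have hmono : ∀ s, r ≤ s → B r ^ 2 ≤ B s ^ 2 := fun s hs =>
    le_of_hasDerivAt_nonneg hs (fun x hx => (h.hasDerivAt_B x (hr.trans_le hx.1)).pow 2)
      (fun x hx => by
        have hx0 : 0 < x := hr.trans_le hx.1
        have h1 : 0 ≤ -(b x * B x) * f x ^ 2 / x :=
          div_nonneg (mul_nonneg (neg_nonneg.2 (hanti x hx.1).le) (sq_nonneg _)) hx0.le
        calc (0 : ℝ) ≤ 2 * (-(b x * B x) * f x ^ 2 / x) := by linarith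
          _ = _ := by push_cast; ring)
  have hB : B r ≠ 0 := fun h0 => by simp [h0] at hneg
  obtain ⟨s, hs, hlt⟩ := exists_sq_lt_of_integrableOn h.B_int (sq_pos_of_ne_zero hB) r
  exact absurd (hmono s hs.le) (not_le.2 hlt)

theorem sq_b_anti (h : IsRadialVortex lam N f f' b B) {r s : ℝ} (hr : 0 < r) (hrs : r ≤ s) :
    b s ^ 2 ≤ b r ^ 2 :=
  le_of_hasDerivAt_nonpos hrs (fun x hx => (h.hasDerivAt_b x (hr.trans_le hx.1)).pow 2)
    (fun x hx => by
      have hx0 : 0 < x := hr.trans_le hx.1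
      have := mul_nonneg hx0.le (h.b_mul_B_nonneg hx0)
      push_cast
      nlinarith)

/-- As b² is nonincreasing, a zero of b persists to the right. Unique continuation for b'' = b'/r +
f²b then gives b = 0 everywhere, against b → 1 at the origin. -/
theorem b_ne_zero (h : IsRadialVortex lam N f f' b B) {r : ℝ} (hr : 0 < r) : b r ≠ 0 := by
  intro h0
  have hzero : ∀ s, r ≤ s → b s = 0 := fun s hs => by
    have := h.sq_b_anti hr hs
    rw [h0] at this
    exact pow_eq_zero_iff two_ne_zero |>.1 (le_antisymm (by simpa using this) (sq_nonneg _))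
  have hr1 : 0 < r + 1 := by linarith
  have hB : -((r + 1) * B (r + 1)) = 0 :=
    (h.hasDerivAt_b _ hr1).unique <| (hasDerivAt_const _ (0 : ℝ)).congr_of_eventuallyEq <| by
      filter_upwards [Ioi_mem_nhds (show r < r + 1 by linarith)] with s hs using hzero s hs.le
  have hall := eq_zero_of_linear_ode (y := b) (y' := fun r => -(r * B r)) (p := fun r => r⁻¹)
    (q := fun r => f r ^ 2) h.hasDerivAt_b (fun x hx => by
      refine ((hasDerivAt_id x).mul (h.hasDerivAt_B x hx)).neg.congr_deriv ?_
      simp only [id]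
      field_simp
      ring)
    (continuousOn_inv₀.mono fun x hx => (mem_Ioi.1 hx).ne') (h.continuousOn_f.pow 2) hr1
    (hzero _ (by linarith)) hB
  have h1 : Tendsto b (𝓝[>] 0) (𝓝 0) := tendsto_const_nhds.congr' <| by
    filter_upwards [self_mem_nhdsWithin] with x hx using (hall x hx).symm
  exact one_ne_zero (tendsto_nhds_unique h.b_zero h1)

theorem b_pos (h : IsRadialVortex lam N f f' b B) {r : ℝ} (hr : 0 < r) : 0 < b r := by
  by_contra! hneg
  obtain ⟨s, hs, hsr⟩ := ((h.b_zero.eventually (lt_mem_nhds one_pos)).and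
    (Ioo_mem_nhdsGT hr)).exists
  obtain ⟨x, hx, hx0⟩ := intermediate_value_Icc' hsr.2.le
    (h.continuousOn_b.mono fun y hy => hsr.1.trans_le hy.1) ⟨hneg, hs.le⟩
  exact h.b_ne_zero (hsr.1.trans_le hx.1) hx0

theorem B_nonneg (h : IsRadialVortex lam N f f' b B) {r : ℝ} (hr : 0 < r) : 0 ≤ B r :=
  nonneg_of_mul_nonneg_right (h.b_mul_B_nonneg hr) (h.b_pos hr)

theorem b_le_one (h : IsRadialVortex lam N f f' b B) {r : ℝ} (hr : 0 < r) : b r ≤ 1 := by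
  refine ge_of_tendsto h.b_zero ?_
  filter_upwards [Ioo_mem_nhdsGT hr] with s hs
  exact (pow_le_pow_iff_left₀ (h.b_pos hr).le (h.b_pos hs.1).le two_ne_zero).1
    (h.sq_b_anti hs.1 hs.2.le)

theorem B_anti (h : IsRadialVortex lam N f f' b B) {r s : ℝ} (hr : 0 < r) (hrs : r ≤ s) :
    B s ≤ B r :=
  le_of_hasDerivAt_nonpos hrs (fun x hx => h.hasDerivAt_B x (hr.trans_le hx.1)) fun x hx => by
    have hx0 : 0 < x := hr.trans_le hx.1
    have := h.b_pos hx0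
    have : 0 ≤ b x * f x ^ 2 / x := by positivity
    linarith

theorem B_infty (h : IsRadialVortex lam N f f' b B) : Tendsto B atTop (𝓝 0) := by
  rw [Metric.tendsto_atTop]
  intro ε hε
  obtain ⟨R, hR, hlt⟩ := exists_sq_lt_of_integrableOn h.B_int (pow_pos hε 2) 0
  refine ⟨R, fun r hr => ?_⟩
  rw [Real.dist_eq, sub_zero, abs_of_nonneg (h.B_nonneg (hR.trans_le hr))]
  exact (h.B_anti hR hr).trans_lt (lt_of_pow_lt_pow_left₀ 2 hε.le hlt)

/-- The Lyapunov function controlling the profile after a critical point of height `μ`. -/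
theorem hasDerivAt_lyapunov (h : IsRadialVortex lam N f f' b B) (μ : ℝ) {r : ℝ} (hr : 0 < r) :
    HasDerivAt (fun r => f' r ^ 2 / 2 - N ^ 2 * b r ^ 2 / r ^ 2 * (f r ^ 2 - μ ^ 2) / 2
      - lam / 8 * (1 - f r ^ 2) ^ 2)
      (-(f' r ^ 2 / r) - N ^ 2 * (b r * B r / r + b r ^ 2 / r ^ 3) * (μ ^ 2 - f r ^ 2)) r := by
  have hf := h.hasDerivAt_f r hr
  have hf2 := hf.pow 2
  have hV := (((h.hasDerivAt_b r hr).pow 2).const_mul (N ^ 2)).div (hasDerivAt_pow 2 r)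
    (pow_pos hr 2).ne'
  refine (((((h.hasDerivAt_f' r hr).pow 2).div_const 2).sub
    ((hV.mul (hf2.sub_const (μ ^ 2))).div_const 2)).sub
    (((hf2.const_sub 1).pow 2).const_mul (lam / 8))).congr_deriv ?_
  simp only [Pi.pow_apply, Pi.div_apply]
  push_cast
  field_simp
  ring

/-- `f²` has no interior maximum on `(0, R]`. -/
theorem no_interior_max (h : IsRadialVortex lam N f f' b B) {m R : ℝ} (hm : 0 < m) (hmR : m < R)
    (hmax : ∀ t, 0 < t → t ≤ R → f t ^ 2 ≤ f m ^ 2) (hR : f R ^ 2 < f m ^ 2) : False := by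
  have hfm : f m ≠ 0 := fun h0 => by
    rw [h0] at hR; nlinarith [sq_nonneg (f R)]
  have hcrit : f' m = 0 := by
    have hloc : IsLocalMax (fun t => f t ^ 2) m := by
      filter_upwards [Ioo_mem_nhds hm hmR] with t ht using hmax t ht.1 ht.2.le
    have := hloc.hasDerivAt_eq_zero ((h.hasDerivAt_f m hm).pow 2)
    simpa [hfm] using this
  -- f cannot be constant beyond m, as f² has dropped at R.
  have hnc : ∀ s, R ≤ s → ¬ ∀ x ∈ Ioo m s, f' x = 0 := fun s hs hz => by
    obtain ⟨c, hc, hslope⟩ := exists_hasDerivAt_eq_slope f f' hmR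
      (h.continuousOn_f.mono fun x hx => hm.trans_le hx.1)
      fun x hx => h.hasDerivAt_f x (hm.trans hx.1)
    rw [hz c ⟨hc.1, hc.2.trans_le hs⟩, eq_comm, div_eq_zero_iff] at hslope
    rcases hslope with h1 | h1
    · rw [sub_eq_zero.1 h1] at hR
      exact lt_irrefl _ hR
    · linarith
  rcases lt_or_ge (f m ^ 2) 1 with hlt | hge
  -- Below height 1, f² never returns to the level f(m)², which contradicts f → 1.
  · have hbd : ∀ s, R ≤ s → f s ^ 2 - f m ^ 2 < 0 := fun s hs => by
      refine neg_of_first_exit (w := fun t => f t ^ 2 - f m ^ 2) (l := R) (u := s)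
        (((h.continuousOn_f.mono fun t ht => (hm.trans hmR).trans_le ht.1).pow 2).sub
          continuousOn_const) (by linarith) (fun y hy hle => ?_) s ⟨hs, le_rfl⟩
      have hle' : ∀ t ∈ Icc m y, f t ^ 2 ≤ f m ^ 2 := fun t ht => by
        rcases le_total t R with htR | htR
        · exact hmax t (hm.trans_le ht.1) htR
        · linarith [hle t ⟨htR, ht.2⟩]
      refine lt_of_le_of_ne (by linarith [hle y ⟨hy.1, le_rfl⟩]) fun heq => ?_
      have hfy : f y ^ 2 = f m ^ 2 := by linarith
      have hsign : ∀ x ∈ Icc m y, 0 ≤ f' x ^ 2 / x ∧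
          0 ≤ N ^ 2 * (b x * B x / x + b x ^ 2 / x ^ 3) * (f m ^ 2 - f x ^ 2) := fun x hx => by
        have hx0 : 0 < x := hm.trans_le hx.1
        have h1 := h.b_mul_B_nonneg hx0
        exact ⟨by positivity, mul_nonneg (by positivity) (by linarith [hle' x hx])⟩
      -- At a return point y the Lyapunov function exceeds its value at the critical point m by
      -- f'(y)²/2 ≥ 0. Being nonincreasing, it is constant on [m, y], so f' = 0 there.
      have hz := hasDerivAt_eq_zero_of_nonpos_of_eq (l := m) (u := y)
        (fun x hx => h.hasDerivAt_lyapunov (f m) (hm.trans_le hx.1))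
        (fun x hx => by linarith [(hsign x hx).1, (hsign x hx).2])
        (by simp only [hfy, hcrit]; nlinarith [sq_nonneg (f' y)])
      refine hnc y hy.1 fun x hx => ?_
      have hx0 : 0 < x := hm.trans hx.1
      have h1 := hsign x ⟨hx.1.le, hx.2.le⟩
      have h2 : f' x ^ 2 / x = 0 := by linarith [hz x hx, h1.1, h1.2]
      simpa [hx0.ne'] using h2
    have : (1 : ℝ) ^ 2 ≤ f m ^ 2 := le_of_tendsto (h.f_infty.pow 2) <| by
      filter_upwards [eventually_ge_atTop R] with s hs using by linarith [hbd s hs]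
    linarith
  -- At height at least 1 the coefficient of f is positive near m. Then r f f', which vanishes at m,
  -- increases, and f² exceeds its maximum just past m.
  · have hcont : ContinuousAt (fun r => N ^ 2 * b r ^ 2 / r ^ 2 + lam / 2 * (f r ^ 2 - 1)) m := by
      have h1 := (h.hasDerivAt_f m hm).continuousAt
      have h2 := (h.hasDerivAt_b m hm).continuousAt
      have h3 : m ^ 2 ≠ 0 := (pow_pos hm 2).ne'
      fun_prop (disch := assumption)
    have hposm : 0 < N ^ 2 * b m ^ 2 / m ^ 2 + lam / 2 * (f m ^ 2 - 1) := by
      have := h.N_pos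
      have := h.b_pos hm
      have := mul_nonneg h.lam_pos.le (sub_nonneg.2 hge)
      have : 0 < N ^ 2 * b m ^ 2 / m ^ 2 := by positivity
      linarith
    have hfc : ContinuousAt f m := (h.hasDerivAt_f m hm).continuousAt
    obtain ⟨δ, hδ, hball⟩ := Metric.eventually_nhds_iff.1
      ((hcont.eventually (lt_mem_nhds hposm)).and ((hfc.eventually_ne hfm).and
        (Ioo_mem_nhds hm hmR)))
    have hpt : ∀ x ∈ Icc m (m + δ / 2), 0 < N ^ 2 * b x ^ 2 / x ^ 2 + lam / 2 * (f x ^ 2 - 1) ∧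
        f x ≠ 0 ∧ x ∈ Ioo 0 R := fun x hx => hball <| by
      rw [Real.dist_eq, abs_of_nonneg (by linarith [hx.1])]; linarith [hx.2]
    have hff : ∀ x ∈ Ioo m (m + δ / 2), 0 < 2 * f x * f' x := fun x hx => by
      have := lt_of_hasDerivAt_pos (l := m) (u := x) hx.1
        (g := fun r => r * (f r * f' r))
        (g' := fun r => r * f' r ^ 2 + r * f r ^ 2 *
          (N ^ 2 * b r ^ 2 / r ^ 2 + lam / 2 * (f r ^ 2 - 1)))
        (fun y hy => by
          have hy0 : 0 < y := hm.trans_le hy.1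
          refine ((hasDerivAt_id y).mul ((h.hasDerivAt_f y hy0).mul
            (h.hasDerivAt_f' y hy0))).congr_deriv ?_
          simp only [id, Pi.mul_apply]
          field_simp
          ring)
        (fun y hy => by
          have hy0 : 0 < y := hm.trans hy.1
          obtain ⟨h1, h2, -⟩ := hpt y ⟨hy.1.le, by linarith [hy.2, hx.2]⟩
          have := mul_pos (mul_pos hy0 (sq_pos_of_ne_zero h2)) h1
          have : 0 ≤ y * f' y ^ 2 := by positivity
          linarith)
      simp only [hcrit, mul_zero] at this
      have := pos_of_mul_pos_right this (hm.trans hx.1).le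
      linarith
    have hlt := lt_of_hasDerivAt_pos (l := m) (u := m + δ / 2) (g := fun r => f r ^ 2)
      (g' := fun r => 2 * f r * f' r) (by linarith)
      (fun x hx => ((h.hasDerivAt_f x (hm.trans_le hx.1)).pow 2).congr_deriv (by simp)) hff
    have h3 := (hpt (m + δ / 2) ⟨by linarith, le_rfl⟩).2.2
    exact absurd (hmax _ h3.1 h3.2.le) (not_le.2 hlt)

end IsRadialVortex

/-! ### Monotonicity and positivity of f; the system for defect and source. -/

namespace IsRadialVortex

variable {lam N : ℝ} {f f' b B : ℝ → ℝ}

theorem sq_f_mono (h : IsRadialVortex lam N f f' b B) {s R : ℝ} (hs : 0 < s) (hsR : s ≤ R) :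
    f s ^ 2 ≤ f R ^ 2 := by
  by_contra! hlt
  have hR : 0 < R := hs.trans_le hsR
  have hfs : 0 < f s ^ 2 := (sq_nonneg _).trans_lt hlt
  have hlim : Tendsto (fun r => f r ^ 2) (𝓝[>] 0) (𝓝 0) := by simpa using h.f_zero.pow 2
  -- Since f → 0 at the origin, values on (0, δ) do not compete, so a maximum over [δ, R] is one
  -- over (0, R].
  obtain ⟨δ, hδ, hsmall⟩ := mem_nhdsGT_iff_exists_Ioo_subset.1 (hlim.eventually (gt_mem_nhds hfs))
  have hδs : δ ≤ s := by
    by_contra! hc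
    exact lt_irrefl _ (show f s ^ 2 < f s ^ 2 from hsmall ⟨hs, hc⟩)
  have hδ0 : (0 : ℝ) < δ := hδ
  obtain ⟨m, hm, hmax⟩ := isCompact_Icc.exists_isMaxOn (s := Icc δ R) ⟨s, hδs, hsR⟩
    ((h.continuousOn_f.mono fun x hx => hδ0.trans_le hx.1).pow 2)
  have hsm : f s ^ 2 ≤ f m ^ 2 := hmax (show s ∈ Icc δ R from ⟨hδs, hsR⟩)
  have hRm : f R ^ 2 < f m ^ 2 := hlt.trans_le hsm
  have hne : m ≠ R := fun heq => by rw [heq] at hRm; exact lt_irrefl _ hRm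
  refine h.no_interior_max (hδ0.trans_le hm.1) (lt_of_le_of_ne hm.2 hne) (fun t ht htR => ?_) hRm
  rcases lt_or_ge t δ with htδ | htδ
  · exact (show f t ^ 2 < f s ^ 2 from hsmall ⟨ht, htδ⟩).le.trans hsm
  · exact hmax (show t ∈ Icc δ R from ⟨htδ, htR⟩)

/-- By monotonicity of f² a zero spreads to the left. Unique continuation then makes f vanish
identically, against f → 1. -/
theorem f_ne_zero (h : IsRadialVortex lam N f f' b B) {r : ℝ} (hr : 0 < r) : f r ≠ 0 := by
  intro h0
  have hzero : ∀ s, 0 < s → s ≤ r → f s = 0 := fun s hs hsr => by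
    have := h.sq_f_mono hs hsr
    rw [h0] at this
    exact pow_eq_zero_iff two_ne_zero |>.1 (le_antisymm (by simpa using this) (sq_nonneg _))
  have hr2 : 0 < r / 2 := half_pos hr
  have hf' : f' (r / 2) = 0 :=
    (h.hasDerivAt_f _ hr2).unique <| (hasDerivAt_const _ (0 : ℝ)).congr_of_eventuallyEq <| by
      filter_upwards [Ioo_mem_nhds hr2 (half_lt_self hr)] with s hs using hzero s hs.1 hs.2.le
  have hinv : ContinuousOn (fun r : ℝ => r⁻¹) (Ioi 0) :=
    continuousOn_inv₀.mono fun x hx => (mem_Ioi.1 hx).ne'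
  have hall := eq_zero_of_linear_ode (y := f) (y' := f') (p := fun r => -r⁻¹)
    (q := fun r => N ^ 2 * b r ^ 2 * r⁻¹ ^ 2 + lam / 2 * (f r ^ 2 - 1)) h.hasDerivAt_f
    (fun x hx => by
      refine (h.hasDerivAt_f' x hx).congr_deriv ?_
      field_simp
      ring)
    hinv.neg
    (((continuousOn_const.mul (h.continuousOn_b.pow 2)).mul (hinv.pow 2)).add
      (continuousOn_const.mul ((h.continuousOn_f.pow 2).sub continuousOn_const)))
    hr2 (hzero _ hr2 (half_le_self hr.le)) hf'
  have h1 : Tendsto f atTop (𝓝 0) := tendsto_const_nhds.congr' <| by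
    filter_upwards [eventually_gt_atTop 0] with x hx using (hall x hx).symm
  exact one_ne_zero (tendsto_nhds_unique h.f_infty h1)

theorem f_pos (h : IsRadialVortex lam N f f' b B) {r : ℝ} (hr : 0 < r) : 0 < f r := by
  by_contra! hneg
  obtain ⟨s, hs, hrs⟩ := ((h.f_infty.eventually (lt_mem_nhds one_pos)).and
    (eventually_ge_atTop r)).exists
  obtain ⟨x, hx, hx0⟩ := intermediate_value_Icc hrs
    (h.continuousOn_f.mono fun y hy => hr.trans_le hy.1) ⟨hneg, hs.le⟩
  exact h.f_ne_zero (hr.trans_le hx.1) hx0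

theorem f'_nonneg (h : IsRadialVortex lam N f f' b B) {r : ℝ} (hr : 0 < r) : 0 ≤ f' r := by
  have hmono : MonotoneOn f (Ioi 0) := fun x hx y hy hxy =>
    (pow_le_pow_iff_left₀ (h.f_pos hx).le (h.f_pos hy).le two_ne_zero).1 (h.sq_f_mono hx hxy)
  have := hmono.derivWithin_nonneg (x := r)
  rwa [((h.hasDerivAt_f r hr).hasDerivWithinAt).derivWithin
    (isOpen_Ioi.uniqueDiffWithinAt hr)] at this

/-- The Bogomolny defect `w = f' - N b f / r`. -/
theorem hasDerivAt_defect (h : IsRadialVortex lam N f f' b B) {r : ℝ} (hr : 0 < r) :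
    HasDerivAt (fun r => f' r - N * b r / r * f r)
      (-((1 + N * b r) / r * (f' r - N * b r / r * f r)) +
        f r * (N * B r - (1 - f r ^ 2) / 2 + (1 - lam) / 2 * (1 - f r ^ 2))) r := by
  refine ((h.hasDerivAt_f' r hr).sub ((((h.hasDerivAt_b r hr).const_mul N).div
    (hasDerivAt_id r) hr.ne').mul (h.hasDerivAt_f r hr))).congr_deriv ?_
  simp only [id, Pi.div_apply]
  field_simp
  ring

/-- The source equals N B - (λ/2)(1 - f²). The split form isolates the part that vanishes at λ = 1.
-/
theorem hasDerivAt_source (h : IsRadialVortex lam N f f' b B) {r : ℝ} (hr : 0 < r) :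
    HasDerivAt (fun r => N * B r - (1 - f r ^ 2) / 2 + (1 - lam) / 2 * (1 - f r ^ 2))
      (f r * (f' r - N * b r / r * f r) - (1 - lam) * (f r * f' r)) r := by
  have h1 := ((h.hasDerivAt_f r hr).pow 2).const_sub 1
  refine ((((h.hasDerivAt_B r hr).const_mul N).sub (h1.div_const 2)).add
    (h1.const_mul ((1 - lam) / 2))).congr_deriv ?_
  push_cast
  field_simp
  ring

theorem tendsto_source (h : IsRadialVortex lam N f f' b B) :
    Tendsto (fun r => N * B r - (1 - f r ^ 2) / 2 + (1 - lam) / 2 * (1 - f r ^ 2)) atTop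
      (𝓝 0) := by
  have h1 := (h.f_infty.pow 2).const_sub 1
  simpa using ((h.B_infty.const_mul N).sub (h1.div_const 2)).add (h1.const_mul ((1 - lam) / 2))

theorem tendsto_defect (h : IsRadialVortex lam N f f' b B) :
    Tendsto (fun r => r * (f' r - N * b r / r * f r)) (𝓝[>] 0) (𝓝 0) := by
  have h1 := h.f'_zero.sub ((h.b_zero.const_mul N).mul h.f_zero)
  rw [mul_zero, sub_zero] at h1
  refine h1.congr' ?_
  filter_upwards [self_mem_nhdsWithin] with r hr
  have : r ≠ 0 := (mem_Ioi.1 hr).ne'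
  field_simp

end IsRadialVortex

/-- Sign of the first component of a cooperative first order system on the half-line whose
components vanish at zero and at infinity, respectively. -/
theorem pos_of_cooperative_system {N : ℝ} {f b w η k : ℝ → ℝ} (hN : 0 < N)
    (hf : ∀ r, 0 < r → 0 < f r) (hb : ∀ r, 0 < r → 0 < b r) (hb1 : ∀ r, 0 < r → b r ≤ 1)
    (hw : ∀ r, 0 < r → HasDerivAt w (-((1 + N * b r) / r * w r) + f r * η r) r)
    (hη : ∀ r, 0 < r → HasDerivAt η (f r * w r - k r) r)
    (hk : ∀ r, 0 < r → 0 ≤ k r) (hk' : ∀ r, 0 < r → w r = 0 → 0 < k r)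
    (hw0 : Tendsto (fun r => r * w r) (𝓝[>] 0) (𝓝 0)) (hη0 : Tendsto η atTop (𝓝 0)) :
    ∀ r, 0 < r → 0 < w r := by
  have hwc : ContinuousOn w (Ioi 0) := fun r hr => (hw r hr).continuousAt.continuousWithinAt
  have hηanti : ∀ l u, 0 < l → l ≤ u → (∀ t ∈ Icc l u, w t ≤ 0) → η u ≤ η l :=
    fun l u hl hlu hneg => le_of_hasDerivAt_nonpos hlu (fun x hx => hη x (hl.trans_le hx.1))
      fun x hx => by
        have hx0 := hl.trans_le hx.1
        have := mul_nonneg (hf x hx0).le (neg_nonneg.2 (hneg x hx))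
        linarith [hk x hx0]
  have hnonneg : ∀ r, 0 < r → 0 ≤ w r := by
    intro r hr
    by_contra! hneg
    rcases le_or_gt (η r) 0 with hηr | hηr
    -- The damping (1 + N b)/r pushes w back towards 0. The weight t^(p+1) with p ≥ N ≥ N b absorbs
    -- it, and t^(p+1) w is nonincreasing.
    · obtain ⟨p, hp⟩ := exists_nat_ge N
      have hall : ∀ s, r ≤ s → w s < 0 := fun s hs => by
        refine neg_of_first_exit (l := r) (u := s) (hwc.mono fun x hx => hr.trans_le hx.1) hneg
          (fun y hy hle => ?_) s ⟨hs, le_rfl⟩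
        have hy0 : 0 < y := hr.trans_le hy.1
        have := le_of_hasDerivAt_nonpos (l := r) (u := y) (g := fun t => t ^ (p + 1) * w t)
          (g' := fun t => t ^ p * ((p - N * b t) * w t) + t ^ (p + 1) * (f t * η t)) hy.1
          (fun t ht => by
            have ht0 : 0 < t := hr.trans_le ht.1
            refine ((hasDerivAt_pow (p + 1) t).mul (hw t ht0)).congr_deriv ?_
            rw [Nat.add_sub_cancel, pow_succ]
            push_cast
            field_simp
            ring)
          (fun t ht => by
            have ht0 : 0 < t := hr.trans_le ht.1
            have h1 : 0 ≤ p - N * b t := by nlinarith [hb1 t ht0]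
            have h2 : η t ≤ 0 := (hηanti r t hr ht.1 fun x hx =>
              hle x ⟨hx.1, hx.2.trans ht.2⟩).trans hηr
            have h3 := mul_nonneg (pow_pos ht0 p).le (mul_nonneg h1 (neg_nonneg.2 (hle t ht)))
            have h4 := mul_nonneg (pow_pos ht0 (p + 1)).le
              (mul_nonneg (hf t ht0).le (neg_nonneg.2 h2))
            linarith)
        by_contra! hwy
        have h1 := mul_nonneg (pow_pos hy0 (p + 1)).le hwy
        have h2 := mul_pos (pow_pos hr (p + 1)) (neg_pos.2 hneg)
        linarith
      have hlt : η (r + 1) < η r := by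
        have := lt_of_hasDerivAt_pos (l := r) (u := r + 1) (by linarith)
          (fun x hx => (hη x (hr.trans_le hx.1)).neg) (fun x hx => by
            have hx0 := hr.trans hx.1
            have := mul_pos (hf x hx0) (neg_pos.2 (hall x hx.1.le))
            linarith [hk x hx0])
        simpa using this
      have : (0 : ℝ) ≤ η (r + 1) := le_of_tendsto hη0 <| by
        filter_upwards [eventually_ge_atTop (r + 1)] with s hs
        exact hηanti _ s (by linarith) hs fun t ht => (hall t (by linarith [ht.1])).le
      linarith
    -- To the left the weight t suffices: (t w)' = -N b w + t f η ≥ 0.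
    · have hrw : ∀ s, 0 < s → s ≤ r → (∀ t ∈ Icc s r, w t ≤ 0) → s * w s ≤ r * w r :=
        fun s hs hsr hle => le_of_hasDerivAt_nonneg hsr
          (g := fun t => t * w t) (g' := fun t => N * b t * -w t + t * (f t * η t))
          (fun t ht => by
            have ht0 : 0 < t := hs.trans_le ht.1
            refine ((hasDerivAt_id t).mul (hw t ht0)).congr_deriv ?_
            simp only [id]
            field_simp
            ring)
          (fun t ht => by
            have ht0 : 0 < t := hs.trans_le ht.1
            have h2 : η r ≤ η t := hηanti t r ht0 ht.2 fun x hx => hle x ⟨ht.1.trans hx.1, hx.2⟩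
            have h3 := mul_nonneg (mul_pos hN (hb t ht0)).le (neg_nonneg.2 (hle t ht))
            have h4 := mul_nonneg ht0.le (mul_nonneg (hf t ht0).le (hηr.le.trans h2))
            linarith)
      have hrneg : r * w r < 0 := mul_neg_of_pos_of_neg hr hneg
      have hall : ∀ s, 0 < s → s ≤ r → ∀ t ∈ Icc s r, w t < 0 := fun s hs hsr =>
        neg_of_last_exit (hwc.mono fun x hx => hs.trans_le hx.1) hneg fun y hy hle =>
          neg_of_mul_neg_right ((hrw y (hs.trans_le hy.1) hy.2 hle).trans_lt hrneg)
            (hs.trans_le hy.1).le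
      have : (0 : ℝ) ≤ r * w r := le_of_tendsto hw0 <| by
        filter_upwards [Ioo_mem_nhdsGT hr] with s hs
        exact hrw s hs.1 hs.2.le fun t ht => (hall s hs.1 hs.2.le t ht).le
      linarith
  intro r hr
  -- A zero of w is a minimum, so w' = 0 and η = 0 there. Then η' = -k < 0 makes η negative just
  -- after, and w decreases below 0.
  refine lt_of_le_of_ne (hnonneg r hr) fun h0 => ?_
  have hmin : IsLocalMin w r := by
    filter_upwards [Ioi_mem_nhds hr] with s hs
    rw [← h0]
    exact hnonneg s hs
  have hηr : η r = 0 := by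
    have := hmin.hasDerivAt_eq_zero (hw r hr)
    simpa [← h0, (hf r hr).ne'] using this
  have hη' := hη r hr
  rw [← h0, mul_zero, zero_sub] at hη'
  have hev : ∀ᶠ s in 𝓝[>] r, η s < 0 := by
    have hs := (hasDerivAt_iff_tendsto_slope.1 hη').mono_left
      (nhdsWithin_mono r fun x (hx : r < x) => hx.ne')
    filter_upwards [hs.eventually (gt_mem_nhds (neg_neg_of_pos (hk' r hr h0.symm))),
      self_mem_nhdsWithin] with s h1 h2
    rw [slope_def_field, hηr, sub_zero] at h1
    have : 0 < s - r := sub_pos.2 h2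
    by_contra! hc
    exact absurd h1 (not_lt.2 (div_nonneg hc this.le))
  obtain ⟨u, hu, hsub⟩ := mem_nhdsGT_iff_exists_Ioo_subset.1 hev
  have hru : r < (r + u) / 2 := by linarith [mem_Ioi.1 hu]
  have := lt_of_hasDerivAt_pos hru (fun x hx => (hw x (hr.trans_le hx.1)).neg) (fun x hx => by
    have hx0 := hr.trans hx.1
    have h1 : η x < 0 := hsub ⟨hx.1, by linarith [hx.2, mem_Ioi.1 hu]⟩
    have h2 := mul_pos (hf x hx0) (neg_pos.2 h1)
    have h3 : 0 ≤ (1 + N * b x) / x * w x :=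
      mul_nonneg (div_nonneg (by nlinarith [mul_pos hN (hb x hx0)]) hx0.le) (hnonneg x hx0)
    linarith)
  simp only [Pi.neg_apply] at this
  linarith [hnonneg _ (hr.trans hru)]

/-! ### The strict inequalities for λ < 1 and λ > 1. -/

namespace IsRadialVortex

variable {lam N : ℝ} {f f' b B : ℝ → ℝ}

theorem f'_pos_of_eq (h : IsRadialVortex lam N f f' b B) {r : ℝ} (hr : 0 < r)
    (h0 : f' r - N * b r / r * f r = 0) : 0 < f' r := by
  have h1 := h.N_pos
  have h2 := h.b_pos hr
  have h3 := h.f_pos hr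
  rw [sub_eq_zero.1 h0]
  positivity

theorem lt_deriv (h : IsRadialVortex lam N f f' b B) (hlam : lam < 1) {r : ℝ} (hr : 0 < r) :
    N * b r / r * f r < f' r :=
  sub_pos.1 <| pos_of_cooperative_system (w := fun r => f' r - N * b r / r * f r)
    h.N_pos (fun _ => h.f_pos) (fun _ => h.b_pos) (fun _ => h.b_le_one)
    (fun _ => h.hasDerivAt_defect) (fun _ => h.hasDerivAt_source)
    (fun _ hs => mul_nonneg (sub_pos.2 hlam).le (mul_nonneg (h.f_pos hs).le (h.f'_nonneg hs)))
    (fun _ hs h0 => mul_pos (sub_pos.2 hlam) (mul_pos (h.f_pos hs) (h.f'_pos_of_eq hs h0)))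
    h.tendsto_defect h.tendsto_source r hr

theorem deriv_lt (h : IsRadialVortex lam N f f' b B) (hlam : 1 < lam) {r : ℝ} (hr : 0 < r) :
    f' r < N * b r / r * f r := by
  have hw0 := h.tendsto_defect.neg
  have hη0 := h.tendsto_source.neg
  rw [neg_zero] at hw0 hη0
  refine sub_neg.1 <| neg_pos.1 <| pos_of_cooperative_system
    (w := fun r => -(f' r - N * b r / r * f r)) (k := fun r => (lam - 1) * (f r * f' r))
    h.N_pos (fun _ => h.f_pos) (fun _ => h.b_pos) (fun _ => h.b_le_one)
    (fun s hs => (h.hasDerivAt_defect hs).neg.congr_deriv ?_)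
    (fun s hs => (h.hasDerivAt_source hs).neg.congr_deriv ?_)
    (fun _ hs => mul_nonneg (sub_pos.2 hlam).le (mul_nonneg (h.f_pos hs).le (h.f'_nonneg hs)))
    (fun _ hs h0 => mul_pos (sub_pos.2 hlam)
      (mul_pos (h.f_pos hs) (h.f'_pos_of_eq hs (neg_eq_zero.1 h0))))
    (hw0.congr fun s => by ring) hη0 r hr
  · simp only [Pi.neg_apply]; ring
  · ring

end IsRadialVortex

/-! ### Partial derivatives and derivatives along circles in the plane. -/

section PlaneCalculus

variable {E : Type*} [NormedAddCommGroup E] [NormedSpace ℝ E] {u : ℝ × ℝ → E}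

theorem fderiv_apply_eq (u : ℝ × ℝ → E) (p : ℝ × ℝ) (s t : ℝ) :
    fderiv ℝ u p (s, t) = s • pd1 u p + t • pd2 u p := by
  rw [pd1, pd2, ← map_smul, ← map_smul, ← map_add]
  simp

theorem hasDerivAt_pd1 {x y : ℝ} (hu : DifferentiableAt ℝ u (x, y)) :
    HasDerivAt (fun s => u (s, y)) (pd1 u (x, y)) x :=
  hu.hasFDerivAt.comp_hasDerivAt x ((hasDerivAt_id x).prodMk (hasDerivAt_const x y))

theorem hasDerivAt_pd2 {x y : ℝ} (hu : DifferentiableAt ℝ u (x, y)) :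
    HasDerivAt (fun t => u (x, t)) (pd2 u (x, y)) y :=
  hu.hasFDerivAt.comp_hasDerivAt y ((hasDerivAt_const y x).prodMk (hasDerivAt_id y))

theorem contDiff_pd1 {m : WithTop ℕ∞} (hu : ContDiff ℝ (m + 1) u) : ContDiff ℝ m (pd1 u) :=
  (hu.fderiv_right le_rfl).clm_apply contDiff_const

theorem contDiff_pd2 {m : WithTop ℕ∞} (hu : ContDiff ℝ (m + 1) u) : ContDiff ℝ m (pd2 u) :=
  (hu.fderiv_right le_rfl).clm_apply contDiff_const

/-- The angular derivative is the derivative along circles. -/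
theorem hasDerivAt_circle {r θ : ℝ} (hu : DifferentiableAt ℝ u (r * Real.cos θ, r * Real.sin θ)) :
    HasDerivAt (fun t => u (r * Real.cos t, r * Real.sin t))
      ((r * Real.cos θ) • pd2 u (r * Real.cos θ, r * Real.sin θ)
        - (r * Real.sin θ) • pd1 u (r * Real.cos θ, r * Real.sin θ)) θ := by
  refine (hu.hasFDerivAt.comp_hasDerivAt θ (((Real.hasDerivAt_cos θ).const_mul r).prodMk
    ((Real.hasDerivAt_sin θ).const_mul r))).congr_deriv ?_
  rw [fderiv_apply_eq]
  module

theorem exists_polar {x : ℝ} (hx : 0 < x) (y : ℝ) :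
    ∃ r θ : ℝ, 0 < r ∧ x = r * Real.cos θ ∧ y = r * Real.sin θ := by
  refine ⟨‖(⟨x, y⟩ : ℂ)‖, Complex.arg ⟨x, y⟩, norm_pos_iff.2 fun h => ?_, ?_, ?_⟩
  · exact hx.ne' (congrArg Complex.re h)
  · rw [Complex.norm_mul_cos_arg]
  · rw [Complex.norm_mul_sin_arg]

end PlaneCalculus

/-! ### Reduction of the planar equations to the radial system. -/

section Equivariant

variable {lam : ℝ} {n : ℤ} {f a : ℝ → ℝ} {ψ : ℝ × ℝ → ℂ} {A : ℝ × ℝ → ℝ × ℝ}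

theorem HasProfiles.psi_axis (h : HasProfiles n f a ψ A) {r : ℝ} (hr : 0 < r) :
    ψ (r, 0) = f r := by
  simpa using (h r 0 hr).1

theorem HasProfiles.A_axis (h : HasProfiles n f a ψ A) {r : ℝ} (hr : 0 < r) :
    A (r, 0) = (0, n * (a r / r)) := by
  simpa using (h r 0 hr).2

/-- Infinitesimal equivariance, obtained along a circle. It is needed off the axis so that it can be
differentiated again in y. -/
theorem HasProfiles.angular_psi (h : HasProfiles n f a ψ A) (hψ : Differentiable ℝ ψ)
    {x : ℝ} (hx : 0 < x) (y : ℝ) :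
    x • pd2 ψ (x, y) - y • pd1 ψ (x, y) = Complex.I * n * ψ (x, y) := by
  obtain ⟨r, θ, hr, rfl, rfl⟩ := exists_polar hx y
  have h1 := hasDerivAt_circle (r := r) (θ := θ) (hψ _)
  rw [(h r θ hr).1]
  refine h1.unique ?_
  have h2 : HasDerivAt (fun t : ℝ => (f r : ℂ) * Complex.exp (Complex.I * n * t))
      (Complex.I * n * ((f r : ℂ) * Complex.exp (Complex.I * n * θ))) θ := by
    have := (((Complex.ofRealCLM.hasDerivAt (x := θ)).const_mul
      (Complex.I * n)).cexp).const_mul (f r : ℂ)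
    refine this.congr_deriv ?_
    simp only [Complex.ofRealCLM_apply, Complex.ofReal_one]
    ring
  exact h2.congr_of_eventuallyEq (Eventually.of_forall fun t => (h r t hr).1)

theorem HasProfiles.pd2_psi_axis (h : HasProfiles n f a ψ A) (hψ : Differentiable ℝ ψ)
    {r : ℝ} (hr : 0 < r) : pd2 ψ (r, 0) = Complex.I * n * f r / r := by
  have hr' : (r : ℂ) ≠ 0 := by exact_mod_cast hr.ne'
  have := h.angular_psi hψ hr 0
  rw [zero_smul, sub_zero, h.psi_axis hr, Complex.real_smul] at this
  rw [← this, mul_div_cancel_left₀ _ hr']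

theorem HasProfiles.angular_A_fst (h : HasProfiles n f a ψ A) (hA : Differentiable ℝ A)
    {r : ℝ} (hr : 0 < r) :
    r * pd2 (fun p => (A p).1) (r, 0) = -(n * (a r / r)) := by
  have h1 := hasDerivAt_circle (u := fun p => (A p).1) (r := r) (θ := 0) (hA.fst _)
  have h2 : HasDerivAt (fun t => n * (a r / r) * -Real.sin t) (-(n * (a r / r))) 0 := by
    simpa using ((Real.hasDerivAt_sin 0).neg.const_mul (n * (a r / r)))
  simpa using h1.unique (h2.congr_of_eventuallyEq
    (Eventually.of_forall fun t => congrArg Prod.fst (h r t hr).2))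

theorem HasProfiles.angular_A_snd (h : HasProfiles n f a ψ A) (hA : Differentiable ℝ A)
    {r : ℝ} (hr : 0 < r) : pd2 (fun p => (A p).2) (r, 0) = 0 := by
  have h1 := hasDerivAt_circle (u := fun p => (A p).2) (r := r) (θ := 0) (hA.snd _)
  have h2 : HasDerivAt (fun t => n * (a r / r) * Real.cos t) 0 0 := by
    simpa using ((Real.hasDerivAt_cos 0).const_mul (n * (a r / r)))
  simpa [hr.ne'] using h1.unique (h2.congr_of_eventuallyEq
    (Eventually.of_forall fun t => congrArg Prod.snd (h r t hr).2))

theorem HasProfiles.psi_zero (h : HasProfiles n f a ψ A) (hn : 0 < n) (hψ : Continuous ψ) :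
    ψ (0, 0) = 0 := by
  have hray : ∀ θ : ℝ, Tendsto (fun r : ℝ => ψ (r * Real.cos θ, r * Real.sin θ)) (𝓝[>] 0)
      (𝓝 (ψ (0, 0))) := fun θ => by
    have : Continuous fun r : ℝ => ψ (r * Real.cos θ, r * Real.sin θ) := by fun_prop
    simpa using (this.tendsto 0).mono_left nhdsWithin_le_nhds
  have hn' : (n : ℂ) ≠ 0 := by exact_mod_cast hn.ne'
  have h1 : Tendsto (fun r : ℝ => -ψ (r * Real.cos 0, r * Real.sin 0)) (𝓝[>] 0)
      (𝓝 (ψ (0, 0))) := by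
    -- On the ray of angle π/n the phase is e^{iπ} = -1, so continuity at the origin gives ψ(0) =
    -- -ψ(0).
    refine (hray (Real.pi / n)).congr' ?_
    filter_upwards [self_mem_nhdsWithin] with r hr
    rw [(h r _ hr).1, (h r 0 hr).1]
    have : Complex.I * n * ((Real.pi / n : ℝ) : ℂ) = Real.pi * Complex.I := by
      push_cast; field_simp
    rw [this, Complex.exp_pi_mul_I]
    simp
  exact self_eq_neg.1 (tendsto_nhds_unique h1 (hray 0).neg)

/-- The profile equation for the order parameter. -/
theorem pd1_pd1_psi_axis (h : HasProfiles n f a ψ A) (hs : IsGLSolution lam ψ A)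
    {r : ℝ} (hr : 0 < r) :
    pd1 (pd1 ψ) (r, 0) = -(pd1 ψ (r, 0) / r) +
      ((n ^ 2 * (1 - a r) ^ 2 / r ^ 2 * f r + lam / 2 * (f r ^ 2 - 1) * f r : ℝ) : ℂ) := by
  have hr' : (r : ℂ) ≠ 0 := by exact_mod_cast hr.ne'
  have hψ : Differentiable ℝ ψ := hs.contDiff_psi.differentiable (by norm_num)
  have hA : Differentiable ℝ A := hs.contDiff_A.differentiable (by norm_num)
  have hψ1 : Differentiable ℝ (pd1 ψ) :=
    (contDiff_pd1 (m := 1) hs.contDiff_psi).differentiable (by norm_num)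
  have hψ2 : Differentiable ℝ (pd2 ψ) :=
    (contDiff_pd2 (m := 1) hs.contDiff_psi).differentiable (by norm_num)
  have hA1 : Differentiable ℝ fun p => ((A p).1 : ℂ) :=
    Complex.ofRealCLM.differentiable.comp hA.fst
  have hA2 : Differentiable ℝ fun p => ((A p).2 : ℂ) :=
    Complex.ofRealCLM.differentiable.comp hA.snd
  have hψy := h.pd2_psi_axis hψ hr
  -- Differentiate x ψ_y - y ψ_x = i n ψ in y at y = 0.
  have hψyy : pd2 (pd2 ψ) (r, 0) = (pd1 ψ (r, 0) + Complex.I * n * pd2 ψ (r, 0)) / r := by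
    have h1 := (((hasDerivAt_pd2 (hψ2 (r, 0))).const_smul r).sub
      ((hasDerivAt_id (0 : ℝ)).smul (hasDerivAt_pd2 (hψ1 (r, 0)))))
    have h2 := (hasDerivAt_pd2 (hψ (r, 0))).const_mul (Complex.I * n)
    have h3 := h1.unique (h2.congr_of_eventuallyEq
      (Eventually.of_forall fun t => h.angular_psi hψ hr t))
    simp only [id, zero_smul, one_smul, zero_add, Complex.real_smul] at h3
    rw [eq_div_iff hr']
    linear_combination h3
  have hcov1 : pd1 (cov1 A ψ) (r, 0) = pd1 (pd1 ψ) (r, 0) := by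
    have hd : Differentiable ℝ (cov1 A ψ) := hψ1.sub ((hA1.const_mul Complex.I).mul hψ)
    refine (hasDerivAt_pd1 (hd (r, 0))).unique
      ((hasDerivAt_pd1 (hψ1 (r, 0))).congr_of_eventuallyEq ?_)
    filter_upwards [Ioi_mem_nhds hr] with s hs
    simp [cov1, h.A_axis hs]
  have hcov2 : pd2 (cov2 A ψ) (r, 0) = pd2 (pd2 ψ) (r, 0)
      - Complex.I * (A (r, 0)).2 * pd2 ψ (r, 0) := by
    have hd : Differentiable ℝ (cov2 A ψ) := hψ2.sub ((hA2.const_mul Complex.I).mul hψ)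
    have hA2y : HasDerivAt (fun t => ((A (r, t)).2 : ℂ)) 0 0 := by
      have := (hasDerivAt_pd2 (u := fun p => (A p).2) (hA.snd (r, 0)))
      rw [h.angular_A_snd hA hr] at this
      simpa using this.ofReal_comp
    refine (hasDerivAt_pd2 (hd (r, 0))).unique (((hasDerivAt_pd2 (hψ2 (r, 0))).sub
      ((hA2y.const_mul Complex.I).mul (hasDerivAt_pd2 (hψ (r, 0))))).congr_deriv ?_)
    simp
  have hnorm : ‖ψ (r, 0)‖ ^ 2 = f r ^ 2 := by
    rw [h.psi_axis hr, Complex.norm_real, Real.norm_eq_abs, sq_abs]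
  have heq := hs.eq_psi (r, 0)
  rw [covLaplacian, cov1, cov2, hcov1, hcov2, cov2, hnorm, h.psi_axis hr, h.A_axis hr, hψyy, hψy] at heq
  push_cast at heq ⊢
  simp only [mul_zero, zero_mul, sub_zero] at heq
  have hI := Complex.I_sq
  field_simp at heq ⊢
  linear_combination (-1 : ℂ) * heq - 2 * f r * n ^ 2 * (1 - a r) ^ 2 * hI

/-- The profile equation for the magnetic field. -/
theorem pd1_curl_axis (h : HasProfiles n f a ψ A) (hs : IsGLSolution lam ψ A)
    {r : ℝ} (hr : 0 < r) :
    pd1 (curl A) (r, 0) = -(n * ((1 - a r) * f r ^ 2 / r)) := by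
  have hr' : (r : ℂ) ≠ 0 := by exact_mod_cast hr.ne'
  have hψ : Differentiable ℝ ψ := hs.contDiff_psi.differentiable (by norm_num)
  have hψy := h.pd2_psi_axis hψ hr
  have hcur : (current A ψ (r, 0)).2 = n * ((1 - a r) * f r ^ 2 / r) := by
    have : (starRingEnd ℂ (ψ (r, 0)) * cov2 A ψ (r, 0))
        = ((n * ((1 - a r) * f r ^ 2 / r) : ℝ) : ℂ) * Complex.I := by
      rw [cov2, h.A_axis hr, hψy, h.psi_axis hr, Complex.conj_ofReal]
      push_cast
      field_simp
    rw [current, this, Complex.im_ofReal_mul, Complex.I_im, mul_one]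
  have heq := congrArg Prod.snd (hs.eq_A (r, 0))
  rw [Prod.snd_sub, hcur] at heq
  simp only [curlScalar, Prod.snd_zero] at heq
  linarith

/-- On the positive axis f = Re ψ, a = r A₂/n and B = curl A / n. The limits at 0 come from
regularity of the fields at the origin, the behaviour at infinity from the integrability class. -/
theorem isRadialVortex_of_isVortexProfile (hlam : 0 < lam) (hn : 0 < n)
    (hfa : IsVortexProfile lam n f a) :
    ∃ f' B : ℝ → ℝ, IsRadialVortex lam n f f' (fun r => 1 - a r) B := by
  obtain ⟨⟨ψ, A, hs, h⟩, hc⟩ := hfa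
  have hn' : (0 : ℝ) < n := by exact_mod_cast hn
  have hψ : Differentiable ℝ ψ := hs.contDiff_psi.differentiable (by norm_num)
  have hA : Differentiable ℝ A := hs.contDiff_A.differentiable (by norm_num)
  have hψ1 : Differentiable ℝ (pd1 ψ) :=
    (contDiff_pd1 (m := 1) hs.contDiff_psi).differentiable (by norm_num)
  have hcurl : Differentiable ℝ (curl A) :=
    ((contDiff_pd1 (m := 1) hs.contDiff_A.snd).sub
      (contDiff_pd2 (m := 1) hs.contDiff_A.fst)).differentiable (by norm_num)
  have haxis : ∀ {E : Type} [TopologicalSpace E] {u : ℝ × ℝ → E}, Continuous u →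
      Tendsto (fun r : ℝ => u (r, 0)) (𝓝[>] 0) (𝓝 (u (0, 0))) := fun hu =>
    ((hu.comp (Continuous.prodMk_left (0 : ℝ))).tendsto 0).mono_left nhdsWithin_le_nhds
  have hre : ∀ {u : ℝ → ℂ} {v : ℂ} {r : ℝ}, HasDerivAt u v r →
      HasDerivAt (fun s => (u s).re) v.re r := fun hu =>
    Complex.reCLM.hasFDerivAt.comp_hasDerivAt _ hu
  have hf : ∀ r, 0 < r → HasDerivAt f (pd1 ψ (r, 0)).re r := fun r hr => by
    refine (hre (hasDerivAt_pd1 (hψ (r, 0)))).congr_of_eventuallyEq ?_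
    filter_upwards [Ioi_mem_nhds hr] with s hs
    rw [h.psi_axis hs, Complex.ofReal_re]
  have haA : ∀ r, 0 < r → a r = r * (A (r, 0)).2 / n := fun r hr => by
    rw [h.A_axis hr]; field_simp
  have ha : ∀ r, 0 < r → HasDerivAt a (r * (curl A (r, 0) / n)) r := fun r hr => by
    have h1 := ((hasDerivAt_id r).mul
      (hasDerivAt_pd1 (u := fun p => (A p).2) (hA.snd (r, 0)))).div_const (n : ℝ)
    refine (h1.congr_of_eventuallyEq ?_).congr_deriv ?_
    · filter_upwards [Ioi_mem_nhds hr] with s hs using haA s hs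
    · have h2 := h.angular_A_fst hA hr
      have h3 : (A (r, 0)).2 = n * (a r / r) := by rw [h.A_axis hr]
      simp only [id, curl]
      rw [h3, ← neg_eq_iff_eq_neg.2 h2]
      ring
  have hf'c : ContinuousOn (fun r => (pd1 ψ (r, 0)).re) (Ioi 0) :=
    (Complex.continuous_re.comp (hψ1.continuous.comp
      (Continuous.prodMk_left (0 : ℝ)))).continuousOn
  refine ⟨fun r => (pd1 ψ (r, 0)).re, fun r => curl A (r, 0) / n, hlam, hn', hf, ?_, ?_, ?_,
    ?_, ?_, ?_, ?_, ?_⟩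
  · intro r hr
    refine (hre (hasDerivAt_pd1 (hψ1 (r, 0)))).congr_deriv ?_
    rw [pd1_pd1_psi_axis h hs hr, Complex.add_re, Complex.ofReal_re, Complex.neg_re,
      Complex.div_ofReal_re]
    ring
  · intro r hr
    exact (ha r hr).const_sub 1
  · intro r hr
    refine ((hasDerivAt_pd1 (hcurl (r, 0))).div_const (n : ℝ)).congr_deriv ?_
    rw [pd1_curl_axis h hs hr]
    field_simp
  · have := haxis (Complex.continuous_re.comp hψ.continuous)
    simp only [Function.comp_apply, h.psi_zero hn hψ.continuous, Complex.zero_re] at this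
    refine this.congr' ?_
    filter_upwards [self_mem_nhdsWithin] with r hr
    rw [h.psi_axis hr, Complex.ofReal_re]
  · have h1 : Tendsto (fun r : ℝ => 1 - r * (A (r, 0)).2 / n) (𝓝[>] 0) (𝓝 1) := by
      simpa using (((tendsto_id.mono_left nhdsWithin_le_nhds).mul
        (haxis (continuous_snd.comp hA.continuous))).div_const (n : ℝ)).const_sub 1
    refine h1.congr' ?_
    filter_upwards [self_mem_nhdsWithin] with r hr
    rw [haA r hr]
  · simpa using (tendsto_id.mono_left nhdsWithin_le_nhds).mul
      (haxis (Complex.continuous_re.comp hψ1.continuous))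
  · have h1 : Tendsto (fun r => 1 - f r) atTop (𝓝 0) :=
      tendsto_zero_of_integrableOn (fun r hr => (hf r hr).const_sub 1) hf'c.neg hc.one_sub_f
        (hc.deriv_f.congr_fun (fun r hr => by
          simp only [(hf r hr).deriv]; ring) measurableSet_Ioi)
    simpa using h1.const_sub 1
  · refine hc.deriv_a_div.congr_fun (fun r hr => ?_) measurableSet_Ioi
    have hr0 : r ≠ 0 := (mem_Ioi.1 hr).ne'
    simp only [(ha r hr).deriv, mul_div_cancel_left₀ _ hr0]

end Equivariant

end MagneticGL

theorem mainTheorem2 (lam : ℝ) (hlam : 0 < lam) (n : ℤ) (hn : 0 < n) (f a : ℝ → ℝ)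
    (hfa : MagneticGL.IsVortexProfile lam n f a) :
    (lam < 1 → ∀ r : ℝ, 0 < r →
      DifferentiableAt ℝ f r ∧ n * (1 - a r) / r * f r < deriv f r) ∧
    (1 < lam → ∀ r : ℝ, 0 < r →
      DifferentiableAt ℝ f r ∧ deriv f r < n * (1 - a r) / r * f r) := by
  obtain ⟨f', B, h⟩ := MagneticGL.isRadialVortex_of_isVortexProfile hlam hn hfa
  refine ⟨fun hl r hr => ⟨(h.hasDerivAt_f r hr).differentiableAt, ?_⟩,
    fun hl r hr => ⟨(h.hasDerivAt_f r hr).differentiableAt, ?_⟩⟩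
  · rw [(h.hasDerivAt_f r hr).deriv]
    exact h.lt_deriv hl hr
  · rw [(h.hasDerivAt_f r hr).deriv]
    exact h.deriv_lt hl hr
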